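/- Let $X,U,Y$ be complex Banach spaces, let $A$ be the generator of a $C_0$-semigroup $\{e^{tA}\}_{t\ge0}$ on $X$ that is exponentially stable (i.e. $\|e^{tA}\|\le Me^{\omega t}$ for all $t\ge0$, for some $M\ge1$, $\omega<0$), and let $B\in\mathcal L(U,X)$, $C\in\mathcal L(X,Y)$. For $\Delta\in\mathcal L(Y,U)$ let $\{e^{t(A+B\Delta C)}\}_{t\ge0}$ be the $C_0$-semigroup generated by $A+B\Delta C$ (with domain $\operatorname{Dom}A$). Define, as suprema in $[0,\infty]$, the constant stability radius $$rc_{stab}(\{e^{tA}\},B,C)=\sup\{r\ge0:\ \|\Delta\|\le r\Rightarrow \{e^{t(A+B\Delta C)}\}_{t\ge0}\text{ is exponentially stable}\},$$ the constant dichotomy radius $$rc_{dich}(\{e^{tA}\},B,C)=\sup\{r\ge0:\ \|\Delta\|\le r\Rightarrow \sigma(e^{t(A+B\Delta C)})\cap\{|z|=1\}=\emptyset\text{ for all }t>0\},$$ and, for $\xi\in[0,1]$ and $A_\xi:=A-i\xi$ (the generator of $\{e^{-i\xi t}e^{tA}\}_{t\ge0}$), the pointwise stability radius $$rc^1_{stab}(e^{2\pi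 A_\xi},B,C)=\sup\{r>0:\ \|\Delta\|\le r\Rightarrow 1\in\rho(e^{2\pi(A_\xi+B\Delta C)})\}.$$ Then $$rc_{dich}(\{e^{tA}\},B,C)=rc_{stab}(\{e^{tA}\},B,C)=\inf_{\xi\in[0,1]}rc^1_{stab}(e^{2\pi A_\xi},B,C).$$ -/

import Mathlib

open Filter Topology
open scoped NNReal ENNReal

/-- A strongly continuous (`C₀`) semigroup of bounded linear operators on `X`. -/
structure C0Semigroup (X : Type*) [NormedAddCommGroup X] [NormedSpace ℂ X] where
  /-- The operator `T t`, for `t ≥ 0`. -/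
  op : ℝ≥0 → X →L[ℂ] X
  op_zero : op 0 = ContinuousLinearMap.id ℂ X
  op_add : ∀ s t : ℝ≥0, op (s + t) = (op s).comp (op t)
  strong_cont : ∀ x : X, Continuous fun t : ℝ≥0 => op t x

namespace C0Semigroup

section Semigroup

variable {X : Type*} [NormedAddCommGroup X] [NormedSpace ℂ X]

/-- The (unbounded) operator `A` is the infinitesimal generator of the semigroup `T`:
`x ∈ Dom A` and `A x = y` if and only if `(T h x - x) / h → y` as `h ↓ 0`.
In particular `Dom A` is exactly the set of all `x` for which this limit exists. -/
def IsGenerator (A : X →ₗ.[ℂ] X) (T : C0Semigroup X) : Prop :=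
  ∀ x y : X, (x, y) ∈ A.graph ↔
    Tendsto (fun h : ℝ≥0 => ((h : ℝ) : ℂ)⁻¹ • (T.op h x - x)) (𝓝[>] 0) (𝓝 y)

/-- Uniform exponential stability: `‖T t‖ ≤ M e^{ωt}` for all `t ≥ 0`, with some `ω < 0`. -/
def IsExpStable (T : C0Semigroup X) : Prop :=
  ∃ M ω : ℝ, 1 ≤ M ∧ ω < 0 ∧ ∀ t : ℝ≥0, ‖T.op t‖ ≤ M * Real.exp (ω * t)

/-- Hyperbolicity: for all `t > 0` the spectrum of `T t` does not meet the unit circle. -/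
def IsHyperbolic (T : C0Semigroup X) : Prop :=
  ∀ t : ℝ≥0, 0 < t → spectrum ℂ (T.op t) ∩ Metric.sphere (0 : ℂ) 1 = ∅

/-- The operator `A - μ`, with domain `Dom A`. -/
def subScalar (A : X →ₗ.[ℂ] X) (μ : ℂ) : X →ₗ.[ℂ] X :=
  (-(μ • LinearMap.id) : X →ₗ[ℂ] X) +ᵥ A

end Semigroup

section Radii

variable {X U Y : Type*} [NormedAddCommGroup X] [NormedSpace ℂ X]
  [NormedAddCommGroup U] [NormedSpace ℂ U] [NormedAddCommGroup Y] [NormedSpace ℂ Y]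

/-- The perturbed operator `A + BΔC`, with domain `Dom A`. -/
def perturbed (A : X →ₗ.[ℂ] X) (B : U →L[ℂ] X) (Δ : Y →L[ℂ] U) (C : X →L[ℂ] Y) :
    X →ₗ.[ℂ] X :=
  ((B ∘L Δ ∘L C : X →L[ℂ] X) : X →ₗ[ℂ] X) +ᵥ A

/-- The constant stability radius: the supremum in `[0, ∞]` of those `r ≥ 0` such that, for every
`Δ` with `‖Δ‖ ≤ r`, the semigroup generated by `A + BΔC` is exponentially stable. -/
noncomputable def constStabRadius (A : X →ₗ.[ℂ] X) (B : U →L[ℂ] X) (C : X →L[ℂ] Y) : ℝ≥0∞ :=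
  ⨆ (r : ℝ≥0) (_ : ∀ Δ : Y →L[ℂ] U, ‖Δ‖ ≤ r →
    ∃ S : C0Semigroup X, IsGenerator (perturbed A B Δ C) S ∧ S.IsExpStable), (r : ℝ≥0∞)

/-- The constant dichotomy radius: the supremum in `[0, ∞]` of those `r ≥ 0` such that, for every
`Δ` with `‖Δ‖ ≤ r`, the semigroup generated by `A + BΔC` is hyperbolic. -/
noncomputable def constDichRadius (A : X →ₗ.[ℂ] X) (B : U →L[ℂ] X) (C : X →L[ℂ] Y) : ℝ≥0∞ :=
  ⨆ (r : ℝ≥0) (_ : ∀ Δ : Y →L[ℂ] U, ‖Δ‖ ≤ r →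
    ∃ S : C0Semigroup X, IsGenerator (perturbed A B Δ C) S ∧ S.IsHyperbolic), (r : ℝ≥0∞)

/-- The pointwise stability radius at `μ` and time `t₀`: the supremum in `[0, ∞]` of those `r > 0`
such that, for every `Δ` with `‖Δ‖ ≤ r`, the number `μ` lies in the resolvent set of the value at
`t₀` of the semigroup generated by `A + BΔC`. -/
noncomputable def pointwiseStabRadius (μ : ℂ) (t₀ : ℝ≥0) (A : X →ₗ.[ℂ] X) (B : U →L[ℂ] X)
    (C : X →L[ℂ] Y) : ℝ≥0∞ :=
  ⨆ (r : ℝ≥0) (_ : 0 < r ∧ ∀ Δ : Y →L[ℂ] U, ‖Δ‖ ≤ r →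
    ∃ S : C0Semigroup X, IsGenerator (perturbed A B Δ C) S ∧
      μ ∈ resolventSet ℂ (S.op t₀)), (r : ℝ≥0∞)

end Radii

end C0Semigroup

/-! All three radii test whether the perturbed semigroup at time `2π` has spectrum off the unit
circle. Exponential stability puts the spectrum at every positive time inside the open disc, which
gives the easy inequalities.

For the converse, join `0` to `Δ` by the segment `τΔ`. The semigroups at time `2π` vary
norm-continuously with `τ` (`norm_op_sub_op_le`, `continuous_op_of_continuous_perturbation`). The
spectrum starts inside the disc and never meets the circle, so it stays inside
(`spectrum_norm_lt_one_of_path`): the resolvent is uniformly bounded on the circle along the path,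
and the maximum principle carries this bound to the outside of the disc. Spectral radius below one
then gives stability. `exists_isExpStable_of_spectrum_norm_ne_one` packages this.

Shifting `A` by `iξ` multiplies the semigroup by `e^{-iξt}`, so `1 ∈ ρ` at time `2π` for all `ξ ∈
[0,1]` says exactly that the whole circle lies in the resolvent set. -/

/-! ### Spectra and the unit disc in a Banach algebra. -/

/-- The maximum principle for `w ↦ (1 - w a)⁻¹` on the closed unit disc. -/
theorem norm_inverse_one_sub_smul_le {R : Type*} [NormedRing R] [NormedAlgebra ℂ R]
    [CompleteSpace R] {a : R} {K : ℝ} (ha : ∀ z ∈ spectrum ℂ a, ‖z‖ < 1)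
    (hK : ∀ w : ℂ, ‖w‖ = 1 → ‖Ring.inverse (1 - w • a)‖ ≤ K) {w : ℂ} (hw : ‖w‖ ≤ 1) :
    IsUnit (1 - w • a) ∧ ‖Ring.inverse (1 - w • a)‖ ≤ K := by
  have hu : ∀ w : ℂ, ‖w‖ ≤ 1 → IsUnit (1 - w • a) := by
    intro w hw
    rcases eq_or_ne w 0 with rfl | h0
    · simp
    · have h1 : w⁻¹ ∉ spectrum ℂ a := fun h => by
        have := ha _ h
        rw [norm_inv] at this
        exact absurd this (not_lt.2 ((one_le_inv₀ (norm_pos_iff.2 h0)).2 hw))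
      rw [spectrum.notMem_iff] at h1
      have h2 := (isUnit_iff_ne_zero.2 h0 : IsUnit w).map (algebraMap ℂ R) |>.mul h1
      convert h2 using 1
      rw [mul_sub, ← map_mul, mul_inv_cancel₀ h0, map_one, Algebra.smul_def]
  refine ⟨hu w hw, ?_⟩
  have hd : ∀ w : ℂ, ‖w‖ ≤ 1 → DifferentiableAt ℂ (fun w : ℂ => Ring.inverse (1 - w • a)) w := by
    intro w hw
    have h1 : DifferentiableAt ℂ (Ring.inverse : R → R) (1 - w • a) :=
      differentiableAt_inverse (𝕜 := ℂ) (hu w hw)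
    have h2 : DifferentiableAt ℂ (fun w : ℂ => 1 - w • a) w := by fun_prop
    exact h1.comp w h2
  have hcl : closure (Metric.ball (0 : ℂ) 1) = Metric.closedBall 0 1 := closure_ball _ one_ne_zero
  refine Complex.norm_le_of_forall_mem_frontier_norm_le (U := Metric.ball (0 : ℂ) 1)
    (f := fun w : ℂ => Ring.inverse (1 - w • a)) Metric.isBounded_ball ?_ ?_ ?_
  · apply DifferentiableOn.diffContOnCl
    intro z hz
    rw [hcl] at hz
    exact (hd z (by simpa using hz)).differentiableWithinAt
  · intro z hz
    rw [frontier_ball _ one_ne_zero] at hz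
    exact hK z (by simpa using hz)
  · rw [hcl]; simpa using hw

/-- For `‖z‖ ≥ 1`, put `w = z⁻¹` and factor `z - b = z(1 - wa)(1 - (1 - wa)⁻¹w(b - a))`. The maximum
principle bounds `(1 - wa)⁻¹` by `K`, so the last factor is a Neumann series. -/
theorem spectrum_norm_lt_one_of_norm_sub_mul_lt {R : Type*} [NormedRing R] [NormedAlgebra ℂ R]
    [CompleteSpace R] {a b : R} {K : ℝ} (ha : ∀ z ∈ spectrum ℂ a, ‖z‖ < 1)
    (hK : ∀ w : ℂ, ‖w‖ = 1 → ‖Ring.inverse (1 - w • a)‖ ≤ K) (hab : ‖b - a‖ * K < 1) :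
    ∀ z ∈ spectrum ℂ b, ‖z‖ < 1 := by
  intro z hz
  by_contra hz1
  rw [not_lt] at hz1
  have hz0 : z ≠ 0 := by rintro rfl; simp at hz1; linarith
  have hw : ‖z⁻¹‖ ≤ 1 := by rw [norm_inv]; exact inv_le_one_of_one_le₀ hz1
  obtain ⟨hu, hb⟩ := norm_inverse_one_sub_smul_le ha hK hw
  refine hz ?_
  have h1 : ‖Ring.inverse (1 - z⁻¹ • a) * (z⁻¹ • (b - a))‖ < 1 := by
    calc _ ≤ K * (1 * ‖b - a‖) := by
          refine (norm_mul_le _ _).trans ?_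
          rw [norm_smul]
          gcongr
          exact (norm_nonneg _).trans hb
      _ < 1 := by linarith
  have h2 := hu.mul (isUnit_one_sub_of_norm_lt_one h1)
  rw [mul_sub, ← mul_assoc, Ring.mul_inverse_cancel _ hu, one_mul, mul_one] at h2
  have h3 := ((isUnit_iff_ne_zero.2 hz0 : IsUnit z).map (algebraMap ℂ R)).mul h2
  rw [← Algebra.smul_def, smul_sub, smul_sub, smul_smul, smul_smul, mul_inv_cancel₀ hz0, one_smul,
    one_smul, sub_sub, add_sub_cancel] at h3
  rwa [spectrum.mem_resolventSet_iff, Algebra.algebraMap_eq_smul_one]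

/-- Along a path whose spectra avoid the unit circle, the spectrum cannot leave the open unit
disc. -/
theorem spectrum_norm_lt_one_of_path {R : Type*} [NormedRing R] [NormedAlgebra ℂ R]
    [CompleteSpace R] {a : unitInterval → R} (hc : Continuous a)
    (hres : ∀ τ, ∀ z ∈ spectrum ℂ (a τ), ‖z‖ ≠ 1)
    (h0 : ∀ z ∈ spectrum ℂ (a 0), ‖z‖ < 1) (τ : unitInterval) :
    ∀ z ∈ spectrum ℂ (a τ), ‖z‖ < 1 := by
  have hu : ∀ τ, ∀ w : ℂ, ‖w‖ = 1 → IsUnit (1 - w • a τ) := by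
    intro τ w hw
    have hw0 : w ≠ 0 := by rintro rfl; simp at hw
    have h1 : w⁻¹ ∉ spectrum ℂ (a τ) := fun h => hres τ _ h (by simp [hw])
    rw [spectrum.notMem_iff] at h1
    have h2 := (isUnit_iff_ne_zero.2 hw0 : IsUnit w).map (algebraMap ℂ R) |>.mul h1
    convert h2 using 1
    rw [mul_sub, ← map_mul, mul_inv_cancel₀ hw0, map_one, Algebra.smul_def]
  obtain ⟨K, hK⟩ : ∃ K : ℝ, ∀ τ, ∀ w : ℂ, ‖w‖ = 1 → ‖Ring.inverse (1 - w • a τ)‖ ≤ K := by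
    have hcomp : IsCompact ((Set.univ : Set unitInterval) ×ˢ Metric.sphere (0 : ℂ) 1) :=
      isCompact_univ.prod (isCompact_sphere _ _)
    obtain ⟨K, hK⟩ := hcomp.exists_bound_of_continuousOn
      (f := fun p : unitInterval × ℂ => Ring.inverse (1 - p.2 • a p.1)) (by
        rintro ⟨τ, w⟩ ⟨-, hw⟩
        obtain ⟨v, hv⟩ := hu τ w (by simpa using hw)
        have h1 : ContinuousAt (Ring.inverse : R → R) (1 - w • a τ) := by
          rw [← hv]; exact NormedRing.inverse_continuousAt v
        have h2 : ContinuousAt (fun p : unitInterval × ℂ => 1 - p.2 • a p.1) (τ, w) := by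
          fun_prop
        exact (ContinuousAt.comp (f := fun p : unitInterval × ℂ => 1 - p.2 • a p.1)
          (g := Ring.inverse) h1 h2).continuousWithinAt)
    exact ⟨K, fun τ w hw => hK (τ, w) ⟨trivial, by simpa using hw⟩⟩
  have hloc : ∀ τ, ∀ᶠ σ in 𝓝 τ, ‖a σ - a τ‖ * K < 1 := by
    intro τ
    have h : Tendsto (fun σ => ‖a σ - a τ‖ * K) (𝓝 τ) (𝓝 (‖a τ - a τ‖ * K)) :=
      Continuous.tendsto (by fun_prop) τ
    exact h.eventually_lt_const (by simp)
  -- The bound `K` does not depend on `τ`, so the perturbation lemma applies in both directions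
  -- between nearby parameters, giving closedness as well as openness.
  have hclopen : IsClopen {τ | ∀ z ∈ spectrum ℂ (a τ), ‖z‖ < 1} := by
    constructor
    · rw [← isOpen_compl_iff, isOpen_iff_mem_nhds]
      intro τ hτ
      filter_upwards [hloc τ] with σ hσ hs
      exact hτ (spectrum_norm_lt_one_of_norm_sub_mul_lt hs (hK σ) (by rwa [norm_sub_rev]))
    · rw [isOpen_iff_mem_nhds]
      intro τ hτ
      filter_upwards [hloc τ] with σ hσ
      exact spectrum_norm_lt_one_of_norm_sub_mul_lt hτ (hK τ) hσ
  exact (hclopen.eq_univ ⟨0, h0⟩).ge (Set.mem_univ τ)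

/-- If the spectrum lies in the open unit disc, then some power is a strict contraction. -/
theorem exists_norm_pow_lt_one_of_spectrum_norm_lt_one {R : Type*} [NormedRing R] [NormedAlgebra ℂ R]
    [CompleteSpace R] {a : R} (ha : ∀ z ∈ spectrum ℂ a, ‖z‖ < 1) :
    ∃ N : ℕ, 0 < N ∧ ‖a ^ N‖ < 1 := by
  have hr : spectralRadius ℂ a < 1 := by
    rcases (spectrum ℂ a).eq_empty_or_nonempty with h | h
    · simp [spectralRadius, h]
    · obtain ⟨z, hz, hzr⟩ := spectrum.exists_nnnorm_eq_spectralRadius_of_nonempty h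
      rw [← hzr]
      exact_mod_cast ha z hz
  obtain ⟨N, hN, hN0⟩ := (((spectrum.pow_nnnorm_pow_one_div_tendsto_nhds_spectralRadius
    a).eventually_lt_const hr).and (eventually_gt_atTop 0)).exists
  refine ⟨N, hN0, ?_⟩
  by_contra hcon
  refine not_le.2 hN (ENNReal.one_le_rpow ?_ (by positivity))
  exact_mod_cast not_lt.1 hcon

/-! ### Generators, bounded perturbations and rescaling. -/

namespace C0Semigroup

variable {X : Type*} [NormedAddCommGroup X] [NormedSpace ℂ X]

theorem map_coe_nhdsGT_zero :
    (𝓝[>] (0 : ℝ≥0)).map ((↑) : ℝ≥0 → ℝ) = 𝓝[>] (0 : ℝ) := by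
  rw [NNReal.isEmbedding_coe.map_nhdsWithin_eq]
  congr 1
  ext x
  simp only [Set.mem_image, Set.mem_Ioi]
  constructor
  · rintro ⟨y, hy, rfl⟩; exact_mod_cast hy
  · intro hx; exact ⟨⟨x, hx.le⟩, hx, rfl⟩

theorem tendsto_quotient_iff_hasDerivWithinAt (f : ℝ → X) (y : X) :
    Tendsto (fun h : ℝ≥0 => ((h : ℝ) : ℂ)⁻¹ • (f h - f 0)) (𝓝[>] 0) (𝓝 y) ↔
      HasDerivWithinAt f y (Set.Ioi 0) 0 := by
  rw [hasDerivWithinAt_iff_tendsto_slope' (by simp), ← map_coe_nhdsGT_zero, tendsto_map'_iff]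
  refine tendsto_congr fun h => ?_
  simp only [Function.comp, slope_def_module, sub_zero, ← Complex.ofReal_inv]
  rw [Complex.coe_smul]

theorem isGenerator_iff_hasDerivWithinAt {G : X →ₗ.[ℂ] X} {T : C0Semigroup X} :
    IsGenerator G T ↔ ∀ x y : X, (x, y) ∈ G.graph ↔
      HasDerivWithinAt (fun h : ℝ => T.op h.toNNReal x) y (Set.Ioi 0) 0 := by
  refine forall_congr' fun x => forall_congr' fun y => ?_
  rw [← tendsto_quotient_iff_hasDerivWithinAt]
  simp [T.op_zero]

theorem exists_norm_op_le [CompleteSpace X] (T : C0Semigroup X) (t : ℝ≥0) :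
    ∃ M : ℝ, 0 < M ∧ ∀ s ≤ t, ‖T.op s‖ ≤ M := by
  obtain ⟨M, hM⟩ := banach_steinhaus (g := fun s : Set.Icc 0 t => T.op s) (fun x => by
    obtain ⟨c, hc⟩ := (isCompact_Icc (a := 0) (b := t)).exists_bound_of_continuousOn
      (T.strong_cont x).continuousOn
    exact ⟨c, fun s => hc s s.2⟩)
  exact ⟨max M 1, by positivity, fun s hs => (hM ⟨s, zero_le, hs⟩).trans (le_max_left _ _)⟩

theorem continuous_op_apply [CompleteSpace X] (T : C0Semigroup X) :
    Continuous fun p : ℝ≥0 × X => T.op p.1 p.2 := by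
  rw [continuous_iff_continuousAt]
  rintro ⟨t, x⟩
  obtain ⟨M, -, hM⟩ := T.exists_norm_op_le (t + 1)
  rw [ContinuousAt, tendsto_iff_norm_sub_tendsto_zero]
  have h1 : Tendsto (fun p : ℝ≥0 × X => M * ‖p.2 - x‖ + ‖T.op p.1 x - T.op t x‖) (𝓝 (t, x))
      (𝓝 (M * ‖x - x‖ + ‖T.op t x - T.op t x‖)) := by
    have h2 : Continuous fun p : ℝ≥0 × X => T.op p.1 x := (T.strong_cont x).comp continuous_fst
    exact Continuous.tendsto (by fun_prop) (t, x)
  simp only [sub_self, norm_zero, mul_zero, add_zero] at h1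
  have h3 : ∀ᶠ p : ℝ≥0 × X in 𝓝 (t, x), p.1 ≤ t + 1 :=
    (continuous_fst.tendsto (t, x)).eventually_le_const (lt_add_one t)
  refine tendsto_of_tendsto_of_tendsto_of_le_of_le' tendsto_const_nhds h1
    (.of_forall fun _ => norm_nonneg _) ?_
  filter_upwards [h3] with p hp
  calc ‖T.op p.1 p.2 - T.op t x‖ = ‖T.op p.1 (p.2 - x) + (T.op p.1 x - T.op t x)‖ := by
        rw [map_sub]; abel_nf
    _ ≤ _ := (norm_add_le _ _).trans (by gcongr; exact (T.op p.1).le_of_opNorm_le (hM _ hp) _)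

theorem op_add_apply (T : C0Semigroup X) (s t : ℝ≥0) (x : X) :
    T.op (s + t) x = T.op s (T.op t x) := by rw [T.op_add]; rfl

theorem op_nsmul (T : C0Semigroup X) (n : ℕ) (t : ℝ≥0) : T.op (n * t) = T.op t ^ n := by
  induction n with
  | zero => simp [T.op_zero]; rfl
  | succ n ih => rw [Nat.cast_succ, add_mul, one_mul, T.op_add, ih, pow_succ]; rfl

open MeasureTheory in
-- The integrals `∫₀ʰ T(s)x ds` lie in the domain, and their averages tend to `x` as `h ↓ 0`.
theorem IsGenerator.dense_domain [CompleteSpace X] {G : X →ₗ.[ℂ] X} {T : C0Semigroup X}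
    (hG : IsGenerator G T) : Dense (G.domain : Set X) := by
  rw [isGenerator_iff_hasDerivWithinAt] at hG
  intro x
  set f : ℝ → X := fun s => T.op s.toNNReal x with hf
  have hfc : Continuous f := (T.strong_cont x).comp continuous_real_toNNReal
  set F : ℝ → X := fun h => ∫ s in (0 : ℝ)..h, f s with hF
  have hFd : ∀ h, HasDerivAt F (f h) h := fun h =>
    intervalIntegral.integral_hasDerivAt_right (hfc.intervalIntegrable _ _)
      (hfc.stronglyMeasurableAtFilter _ _) hfc.continuousAt
  have hop : ∀ h k : ℝ, 0 ≤ h → 0 ≤ k → T.op k.toNNReal (F h) = F (h + k) - F k := by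
    intro h k hh hk
    calc T.op k.toNNReal (F h) = ∫ s in (0 : ℝ)..h, T.op k.toNNReal (f s) :=
          ((T.op k.toNNReal).intervalIntegral_comp_comm (hfc.intervalIntegrable _ _)).symm
      _ = ∫ s in (0 : ℝ)..h, f (s + k) := by
          refine intervalIntegral.integral_congr fun s hs => ?_
          rw [Set.uIcc_of_le hh] at hs
          simp only [hf]
          rw [Real.toNNReal_add hs.1 hk, add_comm, T.op_add_apply]
      _ = ∫ s in k..(h + k), f s := by
          rw [intervalIntegral.integral_comp_add_right f k, zero_add]
      _ = _ := (intervalIntegral.integral_interval_sub_left (hfc.intervalIntegrable _ _)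
          (hfc.intervalIntegrable _ _)).symm
  have hmem : ∀ h : ℝ, 0 ≤ h → F h ∈ G.domain := by
    intro h hh
    have hd : HasDerivWithinAt (fun k : ℝ => T.op k.toNNReal (F h)) (f h - f 0) (Set.Ioi 0) 0 := by
      have h1 : HasDerivAt (fun k => F (h + k) - F k) (f h - f 0) 0 := by
        refine HasDerivAt.sub ?_ (hFd 0)
        exact HasDerivAt.comp_const_add h 0 (by simpa using hFd h)
      refine h1.hasDerivWithinAt.congr (fun k hk => hop h k hh (le_of_lt hk)) ?_
      exact hop h 0 hh le_rfl
    exact LinearPMap.mem_domain_of_mem_graph ((hG _ _).2 hd)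
  have hlim := (tendsto_quotient_iff_hasDerivWithinAt F (f 0)).2 (hFd 0).hasDerivWithinAt
  have hx : f 0 = x := by simp [hf, T.op_zero]
  rw [hx] at hlim
  refine mem_closure_of_tendsto hlim (.of_forall fun h => ?_)
  exact G.domain.smul_mem _ (G.domain.sub_mem (hmem _ h.2) (hmem _ le_rfl))

theorem mem_graph_vadd {A : X →ₗ.[ℂ] X} (K : X →ₗ[ℂ] X) {x y : X} :
    (x, y) ∈ (K +ᵥ A).graph ↔ (x, y - K x) ∈ A.graph := by
  rw [LinearPMap.mem_graph_iff, LinearPMap.mem_graph_iff]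
  constructor
  · rintro ⟨z, rfl, hz⟩
    refine ⟨z, rfl, ?_⟩
    change K z + A z = y at hz
    simp [← hz]
  · rintro ⟨z, rfl, hz⟩
    refine ⟨z, rfl, ?_⟩
    change K z + A z = y
    change A z = y - K z at hz
    simp [hz]

/-- The difference of the semigroups generated by two bounded perturbations of `A`. -/
theorem norm_op_sub_op_le [CompleteSpace X] {A : X →ₗ.[ℂ] X} {K₁ K₂ : X →L[ℂ] X}
    {T₁ T₂ : C0Semigroup X} (h₁ : IsGenerator ((K₁ : X →ₗ[ℂ] X) +ᵥ A) T₁)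
    (h₂ : IsGenerator ((K₂ : X →ₗ[ℂ] X) +ᵥ A) T₂) {t : ℝ≥0} {M₁ M₂ : ℝ}
    (hM₁ : ∀ s ≤ t, ‖T₁.op s‖ ≤ M₁) (hM₂ : ∀ s ≤ t, ‖T₂.op s‖ ≤ M₂) :
    ‖T₂.op t - T₁.op t‖ ≤ M₁ * (‖K₂ - K₁‖ * M₂) * t := by
  have hdense : Dense (A.domain : Set X) := h₁.dense_domain
  have hM₁0 : 0 ≤ M₁ := (norm_nonneg _).trans (hM₁ 0 zero_le)
  have hM₂0 : 0 ≤ M₂ := (norm_nonneg _).trans (hM₂ 0 zero_le)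
  rw [isGenerator_iff_hasDerivWithinAt] at h₁ h₂
  have hinv : ∀ s : ℝ≥0, ∀ x ∈ A.domain, T₂.op s x ∈ A.domain := by
    intro s x hx
    have h3 : (x, A ⟨x, hx⟩ + K₂ x) ∈ ((K₂ : X →ₗ[ℂ] X) +ᵥ A).graph := by
      rw [mem_graph_vadd]
      simpa using A.mem_graph ⟨x, hx⟩
    rw [h₂] at h3
    have h4 := ((T₂.op s).restrictScalars ℝ).hasFDerivAt.comp_hasDerivWithinAt (0 : ℝ) h3
    have h5 : (T₂.op s x, T₂.op s (A ⟨x, hx⟩ + K₂ x)) ∈ ((K₂ : X →ₗ[ℂ] X) +ᵥ A).graph := by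
      rw [h₂]
      have e : ∀ h : ℝ, T₂.op h.toNNReal (T₂.op s x) = T₂.op s (T₂.op h.toNNReal x) := fun h => by
        rw [← T₂.op_add_apply, add_comm, T₂.op_add_apply]
      exact h4.congr (fun h _ => e h) (e 0)
    exact LinearPMap.mem_domain_of_mem_graph ((mem_graph_vadd _).1 h5)
  have hdiff : ∀ z ∈ A.domain, HasDerivWithinAt
      (fun h : ℝ => T₂.op h.toNNReal z - T₁.op h.toNNReal z) ((K₂ - K₁) z) (Set.Ioi 0) 0 := by
    intro z hz
    have e₁ : (z, A ⟨z, hz⟩ + K₁ z) ∈ ((K₁ : X →ₗ[ℂ] X) +ᵥ A).graph := by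
      rw [mem_graph_vadd]; simpa using A.mem_graph ⟨z, hz⟩
    have e₂ : (z, A ⟨z, hz⟩ + K₂ z) ∈ ((K₂ : X →ₗ[ℂ] X) +ᵥ A).graph := by
      rw [mem_graph_vadd]; simpa using A.mem_graph ⟨z, hz⟩
    rw [h₁] at e₁
    rw [h₂] at e₂
    refine (e₂.sub e₁).congr_deriv ?_
    simp
  have key : ∀ x ∈ A.domain, ‖(T₂.op t - T₁.op t) x‖ ≤ M₁ * (‖K₂ - K₁‖ * M₂) * t * ‖x‖ := by
    intro x hx
    -- This path runs from `T₁(t)x` to `T₂(t)x`. In its right derivative `A` cancels, leaving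
    -- `T₁(t-s)(K₂-K₁)T₂(s)x`; a one-sided mean value inequality then suffices.
    set u : ℝ → X := fun s => T₁.op (t - s).toNNReal (T₂.op s.toNNReal x) with hu
    have hT₂c : Continuous fun s : ℝ => T₂.op s.toNNReal x :=
      (T₂.strong_cont x).comp continuous_real_toNNReal
    have huc : Continuous u := by
      have : Continuous fun s : ℝ => (((t : ℝ) - s).toNNReal, T₂.op s.toNNReal x) :=
        (continuous_real_toNNReal.comp (by fun_prop)).prodMk hT₂c
      exact T₁.continuous_op_apply.comp this
    have hder : ∀ s ∈ Set.Ico (0 : ℝ) t, HasDerivWithinAt u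
        (T₁.op (t - s).toNNReal ((K₂ - K₁) (T₂.op s.toNNReal x))) (Set.Ici s) s := by
      rintro s ⟨hs0, hst⟩
      set z := T₂.op s.toNNReal x with hz
      set g : ℝ → X := fun r => T₂.op (r - s).toNNReal z - T₁.op (r - s).toNNReal z with hg
      have hgd : HasDerivWithinAt g ((K₂ - K₁) z) (Set.Ioi s) s := by
        have h3 := HasDerivWithinAt.scomp_of_eq (h := fun r : ℝ => r - s) (h' := 1)
          (s := Set.Ioi s) s (hdiff z (hinv _ _ hx))
          ((hasDerivAt_id s).sub_const s).hasDerivWithinAt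
          (fun r hr => by simpa using hr) (by simp)
        rw [one_smul] at h3
        exact h3
      rw [← hasDerivWithinAt_Ioi_iff_Ici]
      rw [hasDerivWithinAt_iff_tendsto_slope' (by simp)] at hgd ⊢
      have h4 : Tendsto (fun r : ℝ => ((t : ℝ) - r).toNNReal) (𝓝[>] s) (𝓝 (t - s : ℝ).toNNReal) :=
        (Continuous.tendsto (continuous_real_toNNReal.comp (by fun_prop)) s).mono_left
          nhdsWithin_le_nhds
      have h5 := (T₁.continuous_op_apply.tendsto _).comp (h4.prodMk_nhds hgd)
      refine h5.congr' ?_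
      filter_upwards [Ioo_mem_nhdsGT hst] with r hr
      have e1 : T₂.op r.toNNReal x = T₂.op (r - s).toNNReal z := by
        rw [hz, ← T₂.op_add_apply, ← Real.toNNReal_add (by linarith [hr.1]) hs0, sub_add_cancel]
      have e2 : T₁.op (t - s : ℝ).toNNReal z
          = T₁.op (t - r : ℝ).toNNReal (T₁.op (r - s).toNNReal z) := by
        rw [← T₁.op_add_apply, ← Real.toNNReal_add (by linarith [hr.2]) (by linarith [hr.1]),
          sub_add_sub_cancel]
      have e3 : u r - u s = T₁.op (t - r : ℝ).toNNReal (g r) := by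
        simp only [hu, hg]
        rw [← hz, e1, e2, map_sub]
      have e4 : g s = 0 := by simp [hg, T₁.op_zero, T₂.op_zero]
      simp only [Function.comp, slope_def_module, e3, e4, sub_zero]
      exact (T₁.op (t - r : ℝ).toNNReal).map_smul_of_tower _ _
    have hb := norm_image_sub_le_of_norm_deriv_right_le_segment (f := u) huc.continuousOn hder
      (C := M₁ * (‖K₂ - K₁‖ * (M₂ * ‖x‖))) (fun s hs => by
        have b1 : (t - s : ℝ).toNNReal ≤ t := by
          rw [Real.toNNReal_le_iff_le_coe]; linarith [hs.1]
        have b2 : s.toNNReal ≤ t := by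
          rw [Real.toNNReal_le_iff_le_coe]; exact hs.2.le
        refine (ContinuousLinearMap.le_of_opNorm_le _ (hM₁ _ b1) _).trans ?_
        gcongr
        refine (ContinuousLinearMap.le_opNorm _ _).trans ?_
        gcongr
        exact ContinuousLinearMap.le_of_opNorm_le _ (hM₂ _ b2) _) t ⟨t.2, le_rfl⟩
    have e5 : u t - u 0 = (T₂.op t - T₁.op t) x := by
      simp [hu, T₁.op_zero, T₂.op_zero]
    rw [e5] at hb
    refine hb.trans (le_of_eq ?_)
    ring
  refine ContinuousLinearMap.opNorm_le_bound _ (by positivity) fun x => ?_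
  have hcl : IsClosed {x | ‖(T₂.op t - T₁.op t) x‖ ≤ M₁ * (‖K₂ - K₁‖ * M₂) * t * ‖x‖} :=
    isClosed_le (by fun_prop) (by fun_prop)
  exact hcl.closure_subset_iff.2 key (hdense x)

theorem IsGenerator.unique [CompleteSpace X] {G : X →ₗ.[ℂ] X} {T₁ T₂ : C0Semigroup X}
    (h₁ : IsGenerator G T₁) (h₂ : IsGenerator G T₂) : T₁ = T₂ := by
  have hop : T₁.op = T₂.op := by
    funext t
    obtain ⟨M₁, -, hM₁⟩ := T₁.exists_norm_op_le t
    obtain ⟨M₂, -, hM₂⟩ := T₂.exists_norm_op_le t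
    have h0 : (((0 : X →L[ℂ] X) : X →ₗ[ℂ] X) +ᵥ G) = G := zero_vadd _ G
    have h := norm_op_sub_op_le (K₁ := 0) (K₂ := 0) (h0.symm ▸ h₁) (h0.symm ▸ h₂) hM₁ hM₂
    simp only [sub_self, norm_zero, zero_mul, mul_zero] at h
    exact (sub_eq_zero.1 (norm_le_zero_iff.1 h)).symm
  cases T₁; cases T₂; congr

/-- Semigroups generated by bounded perturbations depend continuously, in operator norm, on the
perturbation. -/
theorem continuous_op_of_continuous_perturbation [CompleteSpace X] {ι : Type*}
    [TopologicalSpace ι] {A : X →ₗ.[ℂ] X} {K : ι → X →L[ℂ] X} (hK : Continuous K)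
    {S : ι → C0Semigroup X} (hS : ∀ i, IsGenerator ((K i : X →ₗ[ℂ] X) +ᵥ A) (S i)) (t : ℝ≥0) :
    Continuous fun i => (S i).op t := by
  rw [continuous_iff_continuousAt]
  intro i
  obtain ⟨M, hM0, hM⟩ := (S i).exists_norm_op_le t
  have hlim : ∀ c : ℝ, Tendsto (fun j => c * ‖K j - K i‖) (𝓝 i) (𝓝 0) := by
    intro c
    have h : Tendsto (fun j => c * ‖K j - K i‖) (𝓝 i) (𝓝 (c * ‖K i - K i‖)) :=
      Continuous.tendsto (by fun_prop) i
    simpa using h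
  have hsmall : ∀ᶠ j in 𝓝 i, (M * t) * ‖K j - K i‖ < 1 / 2 :=
    (hlim _).eventually_lt_const (by norm_num)
  rw [ContinuousAt, tendsto_iff_norm_sub_tendsto_zero]
  refine tendsto_of_tendsto_of_tendsto_of_le_of_le' tendsto_const_nhds (hlim (M * (2 * M) * t))
    (.of_forall fun _ => norm_nonneg _) ?_
  filter_upwards [hsmall] with j hj
  have hbd : ∀ s ≤ t, ‖(S j).op s‖ ≤ 2 * M := by
    obtain ⟨N, hN0, hN⟩ := (S j).exists_norm_op_le t
    -- The bound `N` may depend on `j`; it serves only to make the supremum finite, so that `N' ≤ M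
    -- + N'/2` can be solved for `N'`.
    set N' := ⨆ s : Set.Iic t, ‖(S j).op s‖ with hN'
    have hbdd : BddAbove (Set.range fun s : Set.Iic t => ‖(S j).op s‖) :=
      ⟨N, by rintro _ ⟨s, rfl⟩; exact hN s s.2⟩
    have hle : ∀ s ≤ t, ‖(S j).op s‖ ≤ N' := fun s hs => le_ciSup hbdd ⟨s, hs⟩
    have hN'0 : 0 ≤ N' := (norm_nonneg _).trans (hle 0 zero_le)
    have hstep : N' ≤ M + 1 / 2 * N' := by
      have : Nonempty (Set.Iic t) := ⟨⟨t, Set.self_mem_Iic⟩⟩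
      refine ciSup_le fun ⟨s, hs⟩ => ?_
      have h1 := norm_op_sub_op_le (hS i) (hS j) (t := s) (fun r hr => hM r (hr.trans hs))
        (fun r hr => hle r (hr.trans hs))
      have hst : (s : ℝ) ≤ t := hs
      calc ‖(S j).op s‖ = ‖(S i).op s + ((S j).op s - (S i).op s)‖ := by abel_nf
        _ ≤ M + M * (‖K j - K i‖ * N') * s := (norm_add_le _ _).trans (add_le_add (hM s hs) h1)
        _ ≤ M + M * (‖K j - K i‖ * N') * t := by gcongr
        _ = M + (M * t * ‖K j - K i‖) * N' := by ring
        _ ≤ _ := by gcongr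
    exact fun s hs => (hle s hs).trans (by linarith)
  exact (norm_op_sub_op_le (hS i) (hS j) hM hbd).trans (le_of_eq (by ring))

/-- The rescaled semigroup `e^{μt} T(t)`. -/
noncomputable def rescale (T : C0Semigroup X) (μ : ℂ) : C0Semigroup X where
  op t := Complex.exp (μ * (t : ℝ)) • T.op t
  op_zero := by simp [T.op_zero]
  op_add s t := by
    ext x
    simp [T.op_add, mul_add, Complex.exp_add, smul_smul, mul_comm]
  strong_cont x := by
    have := T.strong_cont x
    have h : Continuous fun t : ℝ≥0 => Complex.exp (μ * (t : ℝ)) := by fun_prop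
    exact h.smul this

theorem HasDerivWithinAt.cexp_smul_zero {f : ℝ → X} {y : X}
    (hf : HasDerivWithinAt f y (Set.Ioi 0) 0) (μ : ℂ) :
    HasDerivWithinAt (fun h : ℝ => Complex.exp (μ * h) • f h) (y + μ • f 0) (Set.Ioi 0) 0 := by
  have h1 : HasDerivAt (fun h : ℝ => Complex.exp (μ * h)) μ 0 := by
    have h2 : HasDerivAt (fun z : ℂ => Complex.exp (μ * z)) μ ((0 : ℝ) : ℂ) := by
      simpa using ((hasDerivAt_id (0 : ℂ)).const_mul μ).cexp
    exact h2.comp_ofReal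
  have h3 := h1.hasDerivWithinAt.smul hf (s := Set.Ioi 0)
  refine h3.congr_deriv ?_
  simp

theorem IsGenerator.rescale {G : X →ₗ.[ℂ] X} {T : C0Semigroup X} (hG : IsGenerator G T) (μ : ℂ) :
    IsGenerator (subScalar G μ) (T.rescale (-μ)) := by
  rw [isGenerator_iff_hasDerivWithinAt] at hG ⊢
  intro x y
  rw [subScalar, mem_graph_vadd, hG]
  have e : ∀ h ∈ Set.Ioi (0 : ℝ), (T.rescale (-μ)).op h.toNNReal x
      = Complex.exp (-μ * h) • T.op h.toNNReal x := fun h hh => by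
    simp [C0Semigroup.rescale, max_eq_left (le_of_lt (show (0 : ℝ) < h from hh))]
  have e0 : (T.rescale (-μ)).op (0 : ℝ).toNNReal x = x := by simp [(T.rescale (-μ)).op_zero]
  have e0' : T.op (0 : ℝ).toNNReal x = x := by simp [T.op_zero]
  constructor
  · intro h
    have h1 := HasDerivWithinAt.cexp_smul_zero h (-μ)
    simp only [e0'] at h1
    refine (h1.congr e ?_).congr_deriv (by simp)
    rw [e0, e0']; simp
  · intro h
    have h1 := HasDerivWithinAt.cexp_smul_zero h μ
    simp only [e0] at h1
    refine (h1.congr (fun h hh => ?_) ?_).congr_deriv (by simp)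
    · rw [e h hh, smul_smul, ← Complex.exp_add]; simp
    · rw [e0, e0']; simp

end C0Semigroup

/-! ### Exponential stability and the spectrum at a single time. -/

namespace C0Semigroup

section Stability

variable {X : Type*} [NormedAddCommGroup X] [NormedSpace ℂ X]

theorem IsExpStable.spectrum_norm_lt_one [CompleteSpace X] {T : C0Semigroup X}
    (hT : T.IsExpStable) {t : ℝ≥0} (ht : 0 < t) : ∀ z ∈ spectrum ℂ (T.op t), ‖z‖ < 1 := by
  obtain ⟨M, ω, -, hω, hM⟩ := hT
  intro z hz
  by_contra hz1
  rw [not_lt] at hz1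
  -- The factor `‖1‖` allows for trivial `X`, where the identity has norm zero.
  have hlim : Tendsto (fun n : ℕ => M * Real.exp (ω * t) ^ n * ‖(1 : X →L[ℂ] X)‖) atTop
      (𝓝 (M * 0 * ‖(1 : X →L[ℂ] X)‖)) := by
    refine ((tendsto_pow_atTop_nhds_zero_of_lt_one (Real.exp_nonneg _) ?_).const_mul M).mul_const _
    rw [Real.exp_lt_one_iff]
    exact mul_neg_of_neg_of_pos hω ht
  rw [mul_zero, zero_mul] at hlim
  obtain ⟨n, hn⟩ := (hlim.eventually_lt_const one_pos).exists
  have h1 := spectrum.norm_le_norm_mul_of_mem (spectrum.pow_mem_pow (T.op t) n hz)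
  rw [← T.op_nsmul, norm_pow] at h1
  have h2 : ‖T.op (n * t)‖ ≤ M * Real.exp (ω * t) ^ n := by
    refine (hM _).trans_eq ?_
    rw [← Real.exp_nat_mul]
    congr 2
    push_cast
    ring
  have h3 : (1 : ℝ) ≤ ‖z‖ ^ n := one_le_pow₀ hz1
  have h4 := mul_le_mul_of_nonneg_right h2 (norm_nonneg (1 : X →L[ℂ] X))
  linarith

/-- Some `T(p)`, with `p` a multiple of `t₀`, is a strict contraction; writing `t = np + s` with `s
≤ p` turns its powers into exponential decay. -/
theorem isExpStable_of_spectrum_norm_lt_one [CompleteSpace X] {T : C0Semigroup X} {t₀ : ℝ≥0}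
    (ht₀ : 0 < t₀) (h : ∀ z ∈ spectrum ℂ (T.op t₀), ‖z‖ < 1) : T.IsExpStable := by
  obtain ⟨N, hN, hq⟩ := exists_norm_pow_lt_one_of_spectrum_norm_lt_one h
  rw [← T.op_nsmul] at hq
  set p : ℝ≥0 := N * t₀ with hp
  have hp0 : 0 < p := by positivity
  have hp0' : (0 : ℝ) < p := hp0
  obtain ⟨M, hM0, hM⟩ := T.exists_norm_op_le p
  -- The `1/2` keeps `q` positive, so that `log q` is meaningful even when `T(p) = 0`.
  obtain ⟨q, hq1, hq2⟩ := exists_between (max_lt hq one_half_lt_one)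
  have hqpos : 0 < q := by linarith [le_max_right ‖T.op p‖ (1 / 2)]
  have hlog : Real.log q < 0 := Real.log_neg hqpos hq2
  refine ⟨max 1 (M * q⁻¹), Real.log q / p, le_max_left _ _, div_neg_of_neg_of_pos hlog hp0',
    fun t => ?_⟩
  set n := ⌊t / p⌋₊ with hn
  have hnt : (n : ℝ≥0) * p ≤ t := by
    have := Nat.floor_le (zero_le : 0 ≤ t / p)
    exact (le_div_iff₀ hp0).1 this
  have htn : t < ((n : ℝ≥0) + 1) * p := (div_lt_iff₀ hp0).1 (Nat.lt_floor_add_one (t / p))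
  obtain ⟨s, hs⟩ := exists_add_of_le hnt
  have hsp : s ≤ p := by
    rw [hs, add_mul, one_mul] at htn
    exact (lt_of_add_lt_add_left htn).le
  have hpow : ‖T.op p ^ n * T.op s‖ ≤ q ^ n * M := by
    have h1 : ∀ k : ℕ, ‖T.op p ^ k * T.op s‖ ≤ q ^ k * M := by
      intro k
      induction k with
      | zero => simpa using hM s hsp
      | succ k ih =>
        rw [pow_succ', mul_assoc, pow_succ', mul_assoc]
        refine (norm_mul_le _ _).trans ?_
        gcongr
        exact (le_max_left _ _).trans hq1.le
    exact h1 n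
  have hop : T.op t = T.op p ^ n * T.op s := by
    rw [hs, T.op_add, T.op_nsmul]; rfl
  -- Rounding `t/p` down loses at most one period, which costs the factor `q⁻¹`.
  have hexp : q ^ n ≤ q⁻¹ * Real.exp (Real.log q / p * t) := by
    have h1 : q ^ n = q⁻¹ * Real.exp (Real.log q * (n + 1)) := by
      rw [mul_add, mul_one, Real.exp_add, Real.exp_log hqpos, mul_comm (Real.log q),
        Real.exp_nat_mul, Real.exp_log hqpos]
      field_simp
    rw [h1]
    refine mul_le_mul_of_nonneg_left (Real.exp_le_exp.2 ?_) (inv_nonneg.2 hqpos.le)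
    rw [div_mul_eq_mul_div, mul_div_assoc]
    refine mul_le_mul_of_nonpos_left ?_ hlog.le
    rw [div_le_iff₀ hp0']
    exact_mod_cast htn.le
  rw [hop]
  calc _ ≤ q ^ n * M := hpow
    _ ≤ (q⁻¹ * Real.exp (Real.log q / p * t)) * M := by gcongr
    _ = (M * q⁻¹) * Real.exp (Real.log q / p * t) := by ring
    _ ≤ _ := by gcongr; exact le_max_right _ _

theorem subScalar_zero (A : X →ₗ.[ℂ] X) : subScalar A 0 = A := by
  rw [subScalar, zero_smul, neg_zero, zero_vadd]

end Stability

/-! ### Comparison of the radii. -/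

section Radii

variable {X U Y : Type*} [NormedAddCommGroup X] [NormedSpace ℂ X]
  [NormedAddCommGroup U] [NormedSpace ℂ U] [NormedAddCommGroup Y] [NormedSpace ℂ Y]

theorem perturbed_subScalar (A : X →ₗ.[ℂ] X) (B : U →L[ℂ] X) (Δ : Y →L[ℂ] U) (C : X →L[ℂ] Y)
    (μ : ℂ) : perturbed (subScalar A μ) B Δ C = subScalar (perturbed A B Δ C) μ := by
  rw [perturbed, perturbed, subScalar, subScalar, vadd_vadd, vadd_vadd, add_comm]

theorem perturbed_zero (A : X →ₗ.[ℂ] X) (B : U →L[ℂ] X) (C : X →L[ℂ] Y) :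
    perturbed A B 0 C = A := by
  have h : ((B ∘L (0 : Y →L[ℂ] U) ∘L C : X →L[ℂ] X) : X →ₗ[ℂ] X) = 0 := by ext; simp
  rw [perturbed, h, zero_vadd]

theorem exists_mem_Icc_exp_eq {z : ℂ} (hz : ‖z‖ = 1) :
    ∃ ξ ∈ Set.Icc (0 : ℝ) 1, Complex.exp (2 * Real.pi * (Complex.I * ξ)) = z := by
  obtain ⟨θ, rfl⟩ := (Complex.norm_eq_one_iff z).1 hz
  refine ⟨Int.fract (θ / (2 * Real.pi)), ⟨Int.fract_nonneg _, (Int.fract_lt_one _).le⟩, ?_⟩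
  have hpi : (Real.pi : ℂ) ≠ 0 := by exact_mod_cast Real.pi_ne_zero
  rw [Complex.exp_eq_exp_iff_exists_int]
  refine ⟨-⌊θ / (2 * Real.pi)⌋, ?_⟩
  rw [Int.fract]
  push_cast
  field_simp
  ring

/-- If all perturbations of norm at most `r` keep the unit circle in the resolvent set at one
time, then they all preserve exponential stability. -/
theorem exists_isExpStable_of_spectrum_norm_ne_one [CompleteSpace X] {A : X →ₗ.[ℂ] X}
    {T : C0Semigroup X} (hA : IsGenerator A T) (hT : T.IsExpStable) {B : U →L[ℂ] X}
    {C : X →L[ℂ] Y} {r : ℝ≥0} {t₀ : ℝ≥0} (ht₀ : 0 < t₀)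
    (h : ∀ Δ : Y →L[ℂ] U, ‖Δ‖ ≤ r → ∃ S : C0Semigroup X, IsGenerator (perturbed A B Δ C) S ∧
      ∀ z ∈ spectrum ℂ (S.op t₀), ‖z‖ ≠ 1)
    (Δ : Y →L[ℂ] U) (hΔ : ‖Δ‖ ≤ r) :
    ∃ S : C0Semigroup X, IsGenerator (perturbed A B Δ C) S ∧ S.IsExpStable := by
  have hpath : ∀ τ : unitInterval, ‖((τ : ℝ) : ℂ) • Δ‖ ≤ r := fun τ => by
    rw [norm_smul, Complex.norm_real, Real.norm_of_nonneg τ.2.1]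
    exact (mul_le_of_le_one_left (norm_nonneg _) τ.2.2).trans hΔ
  choose S hS hres using fun τ => h _ (hpath τ)
  have hc : Continuous fun τ => (S τ).op t₀ := by
    refine continuous_op_of_continuous_perturbation
      (K := fun τ : unitInterval => B ∘L (((τ : ℝ) : ℂ) • Δ) ∘L C) ?_ hS t₀
    have e : (fun τ : unitInterval => B ∘L (((τ : ℝ) : ℂ) • Δ) ∘L C)
        = fun τ : unitInterval => ((τ : ℝ) : ℂ) • (B ∘L Δ ∘L C) := by
      funext τ; ext x; simp
    rw [e]
    fun_prop
  have hS0 : S 0 = T := by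
    have h0 := hS 0
    simp only [Set.Icc.coe_zero, Complex.ofReal_zero, zero_smul, perturbed_zero] at h0
    exact h0.unique hA
  have h1 := spectrum_norm_lt_one_of_path hc hres
    (by rw [hS0]; exact hT.spectrum_norm_lt_one ht₀) 1
  refine ⟨S 1, ?_, isExpStable_of_spectrum_norm_lt_one ht₀ h1⟩
  simpa using hS 1

end Radii

end C0Semigroup

open C0Semigroup in
theorem proposition3p6
    {X U Y : Type*}
    [NormedAddCommGroup X] [NormedSpace ℂ X] [CompleteSpace X]
    [NormedAddCommGroup U] [NormedSpace ℂ U] [CompleteSpace U]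
    [NormedAddCommGroup Y] [NormedSpace ℂ Y] [CompleteSpace Y]
    (A : X →ₗ.[ℂ] X) (T : C0Semigroup X) (hA : C0Semigroup.IsGenerator A T)
    (hT : T.IsExpStable) (B : U →L[ℂ] X) (C : X →L[ℂ] Y) :
    C0Semigroup.constDichRadius A B C = C0Semigroup.constStabRadius A B C ∧
    C0Semigroup.constStabRadius A B C =
      ⨅ ξ ∈ Set.Icc (0 : ℝ) 1,
        C0Semigroup.pointwiseStabRadius 1 (2 * NNReal.pi)
          (C0Semigroup.subScalar A (Complex.I * (ξ : ℂ))) B C := by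
  have hpi : (0 : ℝ≥0) < 2 * NNReal.pi := mul_pos two_pos NNReal.pi_pos
  have hpi' : (((2 * NNReal.pi : ℝ≥0) : ℝ) : ℂ) = 2 * Real.pi := by simp
  refine ⟨le_antisymm ?_ ?_, le_antisymm ?_ ?_⟩
  · refine iSup₂_le fun r hr => le_iSup₂_of_le r ?_ le_rfl
    refine exists_isExpStable_of_spectrum_norm_ne_one hA hT hpi fun Δ hΔ => ?_
    obtain ⟨S, hS, hyp⟩ := hr Δ hΔ
    refine ⟨S, hS, fun z hz hz1 => ?_⟩
    have : z ∈ spectrum ℂ (S.op (2 * NNReal.pi)) ∩ Metric.sphere (0 : ℂ) 1 :=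
      ⟨hz, by simpa using hz1⟩
    rw [hyp _ hpi] at this
    exact this
  · refine iSup₂_le fun r hr => le_iSup₂_of_le r (fun Δ hΔ => ?_) le_rfl
    obtain ⟨S, hS, hst⟩ := hr Δ hΔ
    refine ⟨S, hS, fun t ht => Set.eq_empty_of_forall_notMem fun z hz => ?_⟩
    exact (hst.spectrum_norm_lt_one ht z hz.1).ne (by simpa using hz.2)
  · refine le_iInf₂ fun ξ _ => iSup₂_le fun r hr => ?_
    -- The pointwise radius admits only `r > 0`; `r = 0` adds nothing to a supremum.
    rcases eq_or_ne r 0 with rfl | hr0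
    · simp
    refine le_iSup₂_of_le r ⟨pos_iff_ne_zero.2 hr0, fun Δ hΔ => ?_⟩ le_rfl
    obtain ⟨S, hS, hst⟩ := hr Δ hΔ
    rw [perturbed_subScalar]
    refine ⟨_, hS.rescale _, ?_⟩
    by_contra hcon
    change (1 : ℂ) ∈ spectrum ℂ _ at hcon
    have hst' : (S.rescale (-(Complex.I * ξ))).IsExpStable := by
      obtain ⟨M, ω, hM1, hω, hM⟩ := hst
      refine ⟨M, ω, hM1, hω, fun t => ?_⟩
      have e : ‖Complex.exp (-(Complex.I * ξ) * (t : ℝ))‖ = 1 := by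
        rw [Complex.norm_exp]; simp
      change ‖Complex.exp (-(Complex.I * ξ) * (t : ℝ)) • S.op t‖ ≤ _
      rw [norm_smul, e, one_mul]
      exact hM t
    simpa using hst'.spectrum_norm_lt_one hpi 1 hcon
  · refine le_of_forall_lt fun c hc => ?_
    obtain ⟨r, hcr, hr⟩ := ENNReal.lt_iff_exists_nnreal_btwn.1 hc
    refine hcr.trans_le (le_iSup₂_of_le r ?_ le_rfl)
    refine exists_isExpStable_of_spectrum_norm_ne_one hA hT hpi fun Δ hΔ => ?_
    have hξ : ∀ ξ ∈ Set.Icc (0 : ℝ) 1, ∃ S : C0Semigroup X,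
        IsGenerator (subScalar (perturbed A B Δ C) (Complex.I * (ξ : ℂ))) S ∧
          (1 : ℂ) ∈ resolventSet ℂ (S.op (2 * NNReal.pi)) := by
      intro ξ hξ
      obtain ⟨r', ⟨-, hr'⟩, hlt⟩ := by
        have := hr.trans_le (iInf₂_le ξ hξ)
        simpa only [pointwiseStabRadius, lt_iSup_iff, exists_prop] using this
      have h1 : r < r' := by exact_mod_cast hlt
      have h2 := hr' Δ (hΔ.trans (by exact_mod_cast h1.le))
      rwa [perturbed_subScalar] at h2
    obtain ⟨S, hS, -⟩ := hξ 0 ⟨le_rfl, zero_le_one⟩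
    rw [Complex.ofReal_zero, mul_zero, subScalar_zero] at hS
    refine ⟨S, hS, fun z hz hz1 => ?_⟩
    obtain ⟨ξ, hξI, rfl⟩ := exists_mem_Icc_exp_eq hz1
    obtain ⟨S', hS', hres⟩ := hξ ξ hξI
    -- Uniqueness makes `S'` the rescaling of `S`, so `1 ∈ ρ(e^{-2πiξ}S(2π))`; multiplying by
    -- `e^{2πiξ}` gives `e^{2πiξ} ∈ ρ(S(2π))`.
    rw [hS'.unique (hS.rescale _)] at hres
    refine hz ?_
    rw [spectrum.mem_resolventSet_iff] at hres ⊢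
    have h3 := ((isUnit_iff_ne_zero.2 (Complex.exp_ne_zero (2 * Real.pi * (Complex.I * ξ)))).map
      (algebraMap ℂ (X →L[ℂ] X))).mul hres
    convert h3 using 1
    rw [map_one, mul_sub, mul_one, ← Algebra.smul_def]
    change _ = _ - _ • (Complex.exp (-(Complex.I * ξ) * ((2 * NNReal.pi : ℝ≥0) : ℝ)) •
      S.op (2 * NNReal.pi))
    rw [smul_smul, ← Complex.exp_add, hpi']
    have e : 2 * Real.pi * (Complex.I * ξ) + -(Complex.I * ξ) * (2 * Real.pi) = 0 := by ring
    rw [e, Complex.exp_zero, one_smul]
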